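/- Let $d,r,t\ge 0$ be integers and $s=d+r$; write points of $[0,1]^s=[0,1]^d\times[0,1]^r$ as $(q,x)$. Let $(a_k)_{k\ge1}$ be a $(\tau,d)$-sequence in base $b\ge2$: $a_k\in[0,1)^d$, and for all integers $l\ge0$ and $m\ge\tau$ every set $\prod_{j=1}^d[c_jb^{-e_j},(c_j+1)b^{-e_j})$ with integers $e_j\ge0$, $0\le c_j<b^{e_j}$ and $\sum_j e_j=m-\tau$ contains exactly $b^\tau$ of the points $a_k$ with $l b^m<k\le(l+1)b^m$. Let $(q_k)_{k\ge1}$ be the nested uniform (Owen) scrambling of $(a_k)$: if $a_k^j=\sum_{i\ge1}\alpha_i b^{-i}$ is the base-$b$ expansion of the $j$-th coordinate of $a_k$ (the terminating one when there are two), then $q_k^j=\sum_{i\ge1}\pi_{j;\alpha_1\dots\alpha_{i-1}}(\alpha_i)\,b^{-i}$, where the $\pi_{j;\alpha_1\dots\alpha_{i-1}}$, indexed by all $j\in\{1,\dots,d\}$ and all finite strings of digits, are mutually independent, uniformly distributed random permutations of $\{0,\dots,b-1\}$. Let $X_1,X_2,\dots$ be i.i.d. uniform on $[0,1]^r$ and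 independent of these permutations, and let $u_k=(q_k,X_k)$ be the resulting mixed sequence. Let $f:[0,1]^s\to\mathbb R^t$ be bounded and square integrable, and put $Y_k=f(u_k)$, $$\mu(q)=\int_{[0,1]^{r}}f(q,x)\,\mathrm dx,\qquad \mu_k=\mu(q_k),\qquad S_N^{\mathrm{RQMC}}=\frac1N\Big(\sum_{k=1}^N Y_k-\sum_{k=1}^N\mu_k\Big),$$ so that $\mu_k$ is the conditional mean of $Y_k$ given the randomization. Let $$C^2_{\mathrm{qmc-mixed}}=\int_{[0,1]^s}f(u)f(u)^T\,\mathrm du-\int_{[0,1]^d}\mu(q)\,\mu(q)^T\,\mathrm dq .$$ Then $C^2_{\mathrm{qmc-mixed}}$ is positive semidefinite and, as $N\to\infty$, $$N^{1/2}S_N^{\mathrm{RQMC}}\ \xrightarrow{\ \mathcal L\ }\ \mathcal N\big(0,\,C^2_{\mathrm{rqmc-mixed}}\big),\qquad\text{where } C^2_{\mathrm{rqmc-mixed}}=C^2_{\mathrm{qmc-mixed}} .$$ -/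

import Mathlib

open MeasureTheory ProbabilityTheory Filter Topology
open scoped ENNReal unitInterval

namespace MixedRQMC

/-! ### `(t, d)`-sequences in base `b` -/

/-- The `b`-adic elementary interval `∏ⱼ [cⱼ / b ^ eⱼ, (cⱼ + 1) / b ^ eⱼ)`. -/
def elementaryInterval {d : ℕ} (b : ℕ) (e c : Fin d → ℕ) : Set (Fin d → ℝ) :=
  {x | ∀ j, (c j : ℝ) / (b : ℝ) ^ e j ≤ x j ∧ x j < ((c j : ℝ) + 1) / (b : ℝ) ^ e j}

open Classical in
/-- The points `a n`, `n ∈ J`, form a `(t, m, d)`-net in base `b`: there are `b ^ m` of them, and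
every elementary interval contained in `[0, 1)^d` with volume `b ^ (t - m)` contains exactly
`b ^ t` of them (counted with multiplicity). -/
def IsNet {d : ℕ} (b t m : ℕ) (a : ℕ → Fin d → ℝ) (J : Finset ℕ) : Prop :=
  J.card = b ^ m ∧
    ∀ e c : Fin d → ℕ, t + ∑ j, e j = m → (∀ j, c j < b ^ e j) →
      (J.filter fun n => a n ∈ elementaryInterval b e c).card = b ^ t

/-- The infinite sequence `a 0, a 1, …` of points of `[0, 1)^d` is a `(t, d)`-sequence in base `b`:
every block `a n`, `k * b ^ m ≤ n < (k + 1) * b ^ m` with `t ≤ m` is a `(t, m, d)`-net. -/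
def IsTDSequence {d : ℕ} (b t : ℕ) (a : ℕ → Fin d → ℝ) : Prop :=
  (∀ n j, a n j ∈ Set.Ico (0 : ℝ) 1) ∧
    ∀ k m : ℕ, t ≤ m → IsNet b t m a (Finset.Ico (k * b ^ m) ((k + 1) * b ^ m))

/-! ### Nested uniform scrambling -/

/-- Permutations of the finite set of digits carry the discrete σ-algebra. -/
instance instMeasurableSpacePerm (b : ℕ) : MeasurableSpace (Equiv.Perm (Fin b)) := ⊤

/-- The random permutations of a nested uniform scramble: for every coordinate `j` and every finite
string `l` of digits (the digits already read) a uniformly distributed random permutation `π j l` of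
the digits `{0, …, b - 1}`, all of them mutually independent. -/
structure IsUniformScramble {Ω : Type*} [MeasurableSpace Ω] (P : Measure Ω) {d b : ℕ}
    (π : Fin d → List (Fin b) → Ω → Equiv.Perm (Fin b)) : Prop where
  measurable : ∀ j l, Measurable (π j l)
  uniform : ∀ j l ρ, P (π j l ⁻¹' {ρ}) = (Fintype.card (Equiv.Perm (Fin b)) : ℝ≥0∞)⁻¹
  indep : iIndepFun (fun i : Fin d × List (Fin b) => π i.1 i.2) P

/-- Scrambling a digit string: the `k`-th digit is permuted by the permutation that is attached to
the string of the unscrambled digits that precede it. -/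
def scrambleDigits {b : ℕ} (ρ : List (Fin b) → Equiv.Perm (Fin b)) (x : ℕ → Fin b) : ℕ → Fin b :=
  fun k => ρ (List.ofFn fun i : Fin k => x i) (x k)

/-- The scrambled version of the point `a ∈ [0, 1)^d`: in each coordinate, take the base `b` digits,
scramble them, and read the result as a base `b` expansion. -/
noncomputable def scramblePoint {d b : ℕ} [NeZero b]
    (ρ : Fin d → List (Fin b) → Equiv.Perm (Fin b)) (a : Fin d → ℝ) : Fin d → I :=
  fun j => ⟨Real.ofDigits (scrambleDigits (ρ j) (Real.digits (a j) b)),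
    Real.ofDigits_nonneg _, Real.ofDigits_le_one _⟩

/-! ### Mixed sequences, the centred estimator and the asymptotic covariance

The cube `[0, 1]^s` is written as `[0, 1]^d × [0, 1]^r` with `s = d + r`. -/

/-- `∫_{[0,1]^{s-d}} f (q, x) dx`. -/
noncomputable def partialMean {d r t : ℕ}
    (f : (Fin d → I) × (Fin r → I) → EuclideanSpace ℝ (Fin t)) (q : Fin d → I) :
    EuclideanSpace ℝ (Fin t) :=
  ∫ x, f (q, x)

/-- `S_N = N⁻¹ (∑ Y_k - ∑ μ_k)` for the points `u_k = (q_k, x_k)`, `k < N`, where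
`Y_k = f (u_k)` and `μ_k = ∫ f (q_k, x) dx`. -/
noncomputable def centredMean {d r t : ℕ}
    (f : (Fin d → I) × (Fin r → I) → EuclideanSpace ℝ (Fin t))
    (q : ℕ → Fin d → I) (x : ℕ → Fin r → I) (N : ℕ) : EuclideanSpace ℝ (Fin t) :=
  (N : ℝ)⁻¹ • (∑ k ∈ Finset.range N, f (q k, x k) - ∑ k ∈ Finset.range N, partialMean f (q k))

/-- The matrix
`∫_{[0,1]^s} f fᵀ - ∫_{[0,1]^d} (∫_{[0,1]^{s-d}} f dx) (∫_{[0,1]^{s-d}} f dx)ᵀ dq`, entrywise. -/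
noncomputable def mixedCovariance {d r t : ℕ}
    (f : (Fin d → I) × (Fin r → I) → EuclideanSpace ℝ (Fin t)) : Matrix (Fin t) (Fin t) ℝ :=
  Matrix.of fun i j =>
    (∫ u, f u i * f u j) - ∫ q : Fin d → I, partialMean f q i * partialMean f q j

end MixedRQMC

namespace MixedRQMC

/-! Given the scrambling, the vectors `Y_k - μ_k` are independent, centred and bounded, so a central
limit theorem holds as soon as their averaged conditional covariances converge. In a direction `ξ`
the conditional variance of the `k`-th term is `v (q_k)` with `v q = ∫ x, centredInner f ξ (q, x) ^
2`, and `∫ v` is the quadratic form of `mixedCovariance f` at `ξ`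
(`dotProduct_mixedCovariance_mulVec`). What remains is a law of large numbers for `v (q_k)`, where
`v` is only known to be integrable.

That law rests on two facts. Scrambling permutes the elementary cubes of side `b⁻ᵉ`, so every
realization keeps the net property on these cubes, and averages of a continuous function converge
uniformly over all scrambles (`IsTDSequence.exists_forall_abs_average_sub_integral_le`). Each single
`q_k` is uniform (`IsUniformScramble.measurePreserving_scramblePoint`), so replacing `v` by a
continuous `g` costs at most the `L¹` distance in expectation. Together they give convergence in
`L¹(P)` (`IsUniformScramble.tendsto_integral_abs_average_sub`).

For the limit theorem, Fubini factors the conditional characteristic function. Each factor is within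
`O(N^(-3/2))` of a Gaussian one, the product of the Gaussian factors depends only on the averaged
variance, and Lévy's continuity theorem concludes (`tendsto_integral_cexp_sum`). A merely a.e.
measurable `f` is replaced by a measurable version, which uniformity of the `u_k` permits. -/

/-! ### Base `b` prefixes -/

/-- The natural number with base `b` digits `c 0, …, c (e - 1)`, most significant digit first. -/
def prefixValue {b : ℕ} (c : ℕ → Fin b) : ℕ → ℕ
  | 0 => 0
  | e + 1 => b * prefixValue c e + c e

lemma prefixValue_lt {b : ℕ} (c : ℕ → Fin b) (e : ℕ) : prefixValue c e < b ^ e := by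
  induction e with
  | zero => simp [prefixValue]
  | succ e ih =>
    have h : b * (prefixValue c e + 1) ≤ b * b ^ e := Nat.mul_le_mul_left b ih
    have := (c e).isLt
    rw [prefixValue, pow_succ']
    linarith

lemma prefixValue_eq_iff {b : ℕ} (c c' : ℕ → Fin b) (e : ℕ) :
    prefixValue c e = prefixValue c' e ↔ ∀ i < e, c i = c' i := by
  induction e with
  | zero => simp [prefixValue]
  | succ e ih =>
    rw [Nat.forall_lt_succ_right, ← ih, prefixValue, prefixValue]
    constructor
    · intro h
      have h1 : ((b * prefixValue c e + c e) / b : ℕ) = (b * prefixValue c' e + c' e) / b := by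
        rw [h]
      have hb : 0 < b := (c e).pos
      have h2 : prefixValue c e = prefixValue c' e := by
        simpa [Nat.mul_add_div hb, Nat.div_eq_of_lt (c e).isLt,
          Nat.div_eq_of_lt (c' e).isLt] using h1
      refine ⟨h2, Fin.ext ?_⟩
      rw [h2] at h
      exact Nat.add_left_cancel h
    · rintro ⟨h1, h2⟩
      rw [h1, h2]

lemma floor_eq_prefixValue_digits {b : ℕ} [NeZero b] {x : ℝ} (hx : x ∈ Set.Ico (0 : ℝ) 1)
    (e : ℕ) : ⌊(b : ℝ) ^ e * x⌋₊ = prefixValue (Real.digits x b) e := by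
  induction e with
  | zero => simpa [prefixValue] using hx.2
  | succ e ih =>
    -- Division of `⌊b * y⌋₊` by `b`, with `y = b ^ e * x`, has quotient `⌊y⌋₊` and the next digit
    -- as remainder.
    rw [prefixValue, ← ih, Real.digits, Fin.val_ofNat, mul_comm x, pow_succ', mul_assoc]
    rw [← Nat.cast_mul_floor_div_cancel (a := (b : ℝ) ^ e * x) (NeZero.ne b), Nat.div_add_mod]

lemma digits_eq_iff {b : ℕ} [NeZero b] {x : ℝ} (hx : x ∈ Set.Ico (0 : ℝ) 1)
    (c : ℕ → Fin b) (e : ℕ) :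
    (∀ i < e, Real.digits x b i = c i) ↔
      (prefixValue c e : ℝ) / (b : ℝ) ^ e ≤ x ∧ x < ((prefixValue c e : ℝ) + 1) / (b : ℝ) ^ e := by
  have hb : (0 : ℝ) < (b : ℝ) ^ e := pow_pos (Nat.cast_pos.2 (NeZero.pos b)) e
  rw [← prefixValue_eq_iff, ← floor_eq_prefixValue_digits hx,
    Nat.floor_eq_iff (mul_nonneg hb.le hx.1), div_le_iff₀' hb, lt_div_iff₀' hb]

/-- Extend a finite string of digits by zeros. -/
def padDigits {b e : ℕ} [NeZero b] (c : Fin e → Fin b) : ℕ → Fin b :=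
  fun i => if h : i < e then c ⟨i, h⟩ else 0

/-- The first `e` digits of a point given by digit strings. -/
def digitPrefix {d b : ℕ} (e : ℕ) (y : Fin d → ℕ → Fin b) : Fin d → Fin e → Fin b :=
  fun j i => y j i

lemma padDigits_digitPrefix {d b e : ℕ} [NeZero b] (y : Fin d → ℕ → Fin b) (j : Fin d) {i : ℕ}
    (hi : i < e) : padDigits (digitPrefix e y j) i = y j i := by
  simp [padDigits, digitPrefix, hi]

lemma digitPrefix_eq_iff {d b e : ℕ} [NeZero b] (y : Fin d → ℕ → Fin b)
    (c : Fin d → Fin e → Fin b) :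
    digitPrefix e y = c ↔ ∀ j, ∀ i < e, y j i = padDigits (c j) i := by
  simp only [funext_iff, digitPrefix, padDigits]
  refine forall_congr' fun j => Fin.forall_iff.trans ?_
  refine forall_congr' fun i => forall_congr' fun hi => ?_
  rw [dif_pos hi]

/-- The point of `[0, 1]^d` with given base `b` expansions. -/
noncomputable def ofDigitsPoint {d b : ℕ} (y : Fin d → ℕ → Fin b) : Fin d → I :=
  fun j => ⟨Real.ofDigits (y j), Real.ofDigits_nonneg _, Real.ofDigits_le_one _⟩

lemma dist_ofDigitsPoint_le {d b e : ℕ} {y z : Fin d → ℕ → Fin b}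
    (h : ∀ j, ∀ i < e, y j i = z j i) :
    dist (ofDigitsPoint y) (ofDigitsPoint z) ≤ ((b : ℝ) ^ e)⁻¹ :=
  (dist_pi_le_iff (by positivity)).2 fun j => by
    rw [Subtype.dist_eq, Real.dist_eq]
    exact Real.abs_ofDigits_sub_ofDigits_le (h j)

/-- The left end point of the elementary cube that belongs to a prefix. -/
noncomputable def cubePoint {d b e : ℕ} [NeZero b] (c : Fin d → Fin e → Fin b) : Fin d → I :=
  ofDigitsPoint fun j => padDigits (c j)

lemma dist_cubePoint_le {d b : ℕ} [NeZero b] (e : ℕ) (y : Fin d → ℕ → Fin b) :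
    dist (cubePoint (digitPrefix e y)) (ofDigitsPoint y) ≤ ((b : ℝ) ^ e)⁻¹ :=
  dist_ofDigitsPoint_le fun j _ hi => padDigits_digitPrefix y j hi

/-! ### Scrambling acts bijectively on prefixes -/

lemma scrambleDigits_congr {b e : ℕ} (ρ : List (Fin b) → Equiv.Perm (Fin b)) {x y : ℕ → Fin b}
    (h : ∀ i < e, x i = y i) : ∀ i < e, scrambleDigits ρ x i = scrambleDigits ρ y i := by
  intro i hi
  have : (List.ofFn fun k : Fin i => x k) = List.ofFn fun k : Fin i => y k :=
    congrArg _ (funext fun k => h k (k.isLt.trans hi))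
  rw [scrambleDigits, scrambleDigits, this, h i hi]

/-- The digits are recovered one by one: once the earlier ones agree, both strings meet the same
permutation at the next place. -/
lemma scrambleDigits_inj {b e : ℕ} (ρ : List (Fin b) → Equiv.Perm (Fin b)) {x y : ℕ → Fin b}
    (h : ∀ i < e, scrambleDigits ρ x i = scrambleDigits ρ y i) : ∀ i < e, x i = y i := by
  intro i
  induction i using Nat.strong_induction_on with
  | _ i ih =>
    intro hi
    have hl : (List.ofFn fun k : Fin i => x k) = List.ofFn fun k : Fin i => y k :=
      congrArg _ (funext fun k => ih k k.isLt (k.isLt.trans hi))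
    have := h i hi
    rw [scrambleDigits, scrambleDigits, hl] at this
    exact (ρ _).injective this

/-- The action of a scramble on prefixes of length `e`. -/
def scramblePrefix {d b : ℕ} [NeZero b] (ρ : Fin d → List (Fin b) → Equiv.Perm (Fin b)) {e : ℕ}
    (c : Fin d → Fin e → Fin b) : Fin d → Fin e → Fin b :=
  digitPrefix e fun j => scrambleDigits (ρ j) (padDigits (c j))

lemma scramblePrefix_digitPrefix {d b : ℕ} [NeZero b]
    (ρ : Fin d → List (Fin b) → Equiv.Perm (Fin b)) (e : ℕ) (y : Fin d → ℕ → Fin b) :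
    scramblePrefix ρ (digitPrefix e y) = digitPrefix e fun j => scrambleDigits (ρ j) (y j) := by
  funext j i
  exact scrambleDigits_congr (ρ j) (fun k hk => padDigits_digitPrefix y j hk) i i.isLt

lemma scramblePrefix_bijective {d b : ℕ} [NeZero b]
    (ρ : Fin d → List (Fin b) → Equiv.Perm (Fin b)) (e : ℕ) :
    Function.Bijective (scramblePrefix ρ : (Fin d → Fin e → Fin b) → _) := by
  refine Finite.injective_iff_bijective.1 fun c c' h => ?_
  funext j i
  have := scrambleDigits_inj (ρ j) (x := padDigits (c j)) (y := padDigits (c' j)) (e := e)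
    (fun k hk => congrFun (congrFun h j) ⟨k, hk⟩) i i.isLt
  simpa [padDigits] using this

/-! ### Equidistribution of the scrambled net -/

/-- The base `b` expansions of the coordinates of a point. -/
noncomputable def pointDigits {d : ℕ} (b : ℕ) [NeZero b] (x : Fin d → ℝ) : Fin d → ℕ → Fin b :=
  fun j => Real.digits (x j) b

lemma digitPrefix_pointDigits_eq_iff {d b e : ℕ} [NeZero b] {x : Fin d → ℝ}
    (hx : ∀ j, x j ∈ Set.Ico (0 : ℝ) 1) (c : Fin d → Fin e → Fin b) :
    digitPrefix e (pointDigits b x) = c ↔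
      x ∈ elementaryInterval b (fun _ => e) fun j => prefixValue (padDigits (c j)) e := by
  rw [digitPrefix_eq_iff]
  exact forall_congr' fun j => digits_eq_iff (hx j) _ e

/-- The net property with all `e_j = e` says that each prefix occurs exactly `b ^ τ` times in the
block. -/
lemma sum_block_digitPrefix {d b τ : ℕ} [NeZero b] {a : ℕ → Fin d → ℝ}
    (ha : IsTDSequence b τ a) (e k : ℕ) (G : (Fin d → Fin e → Fin b) → ℝ) :
    ∑ n ∈ Finset.Ico (k * b ^ (τ + d * e)) ((k + 1) * b ^ (τ + d * e)),
        G (digitPrefix e (pointDigits b (a n))) = (b : ℝ) ^ τ * ∑ c, G c := by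
  classical
  rw [← Finset.sum_fiberwise _ (fun n => digitPrefix e (pointDigits b (a n))), Finset.mul_sum]
  refine Finset.sum_congr rfl fun c _ => ?_
  rw [Finset.sum_congr rfl (g := fun _ => G c) (fun n hn => by rw [(Finset.mem_filter.1 hn).2]),
    Finset.sum_const, nsmul_eq_mul]
  congr 1
  have hcard := (ha.2 k (τ + d * e) (Nat.le_add_right _ _)).2 (fun _ => e)
    (fun j => prefixValue (padDigits (c j)) e) (by simp) (fun j => prefixValue_lt _ _)
  rw [← Nat.cast_pow, ← hcard]
  congr 2
  ext n
  simp only [Finset.mem_filter, digitPrefix_pointDigits_eq_iff (ha.1 n)]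

/-- The average of `g` over the left end points of the elementary cubes of side `b⁻ᵉ`. -/
noncomputable def cubeAverage {d : ℕ} (b : ℕ) [NeZero b] (e : ℕ) (g : (Fin d → I) → ℝ) : ℝ :=
  ((b : ℝ) ^ (d * e))⁻¹ * ∑ c : Fin d → Fin e → Fin b, g (cubePoint c)

/-- No randomness is involved: for each fixed `ρ` the scramble only reindexes the sum over prefixes,
so the value does not depend on `ρ`. -/
lemma sum_block_cubePoint {d b τ : ℕ} [NeZero b] {a : ℕ → Fin d → ℝ}
    (ha : IsTDSequence b τ a) (e k : ℕ) (ρ : Fin d → List (Fin b) → Equiv.Perm (Fin b))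
    (g : (Fin d → I) → ℝ) :
    ∑ n ∈ Finset.Ico (k * b ^ (τ + d * e)) ((k + 1) * b ^ (τ + d * e)),
        g (cubePoint (digitPrefix e fun j => scrambleDigits (ρ j) (pointDigits b (a n) j))) =
      (b : ℝ) ^ (τ + d * e) * cubeAverage b e g := by
  have hb : (b : ℝ) ^ (d * e) ≠ 0 := pow_ne_zero _ (NeZero.ne _)
  simp only [← scramblePrefix_digitPrefix]
  rw [sum_block_digitPrefix ha e k fun c => g (cubePoint (scramblePrefix ρ c)), cubeAverage,
    (scramblePrefix_bijective ρ e).sum_comp fun c => g (cubePoint c),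
    pow_add, mul_assoc, mul_inv_cancel_left₀ hb]

/-! ### The scrambled points are uniformly distributed -/

lemma measurable_ofDigitsPoint {d b : ℕ} :
    Measurable (ofDigitsPoint : (Fin d → ℕ → Fin b) → Fin d → I) :=
  measurable_pi_lambda _ fun j =>
    (Real.continuous_ofDigits.measurable.comp (measurable_pi_apply j)).subtype_mk

lemma measurable_digitPrefix {d b e : ℕ} :
    Measurable (digitPrefix e : (Fin d → ℕ → Fin b) → Fin d → Fin e → Fin b) := by
  unfold digitPrefix
  fun_prop

/-- All digits of the random digit strings `D` are independent and uniformly distributed. -/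
structure HasUniformDigits {Ω : Type*} [MeasurableSpace Ω] (P : Measure Ω) {d b : ℕ}
    (D : Ω → Fin d → ℕ → Fin b) : Prop where
  measurable : Measurable D
  measure_prefix : ∀ e (c : Fin d → Fin e → Fin b),
    P {ω | digitPrefix e (D ω) = c} = ((b : ℝ≥0∞)⁻¹) ^ (d * e)

lemma HasUniformDigits.integral_digitPrefix {Ω : Type*} [MeasurableSpace Ω] {P : Measure Ω}
    [IsProbabilityMeasure P] {d b : ℕ} {D : Ω → Fin d → ℕ → Fin b} (hD : HasUniformDigits P D)
    {e : ℕ} (G : (Fin d → Fin e → Fin b) → ℝ) :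
    ∫ ω, G (digitPrefix e (D ω)) ∂P = ((b : ℝ) ^ (d * e))⁻¹ * ∑ c, G c := by
  have hm : Measurable fun ω => digitPrefix e (D ω) := measurable_digitPrefix.comp hD.measurable
  have : IsProbabilityMeasure (P.map fun ω => digitPrefix e (D ω)) :=
    Measure.isProbabilityMeasure_map hm.aemeasurable
  rw [← integral_map (φ := fun ω => digitPrefix e (D ω)) hm.aemeasurable
    (measurable_of_countable G).aestronglyMeasurable, integral_fintype .of_finite, Finset.mul_sum]
  refine Finset.sum_congr rfl fun c _ => ?_
  rw [Measure.real, Measure.map_apply hm (measurableSet_singleton c)]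
  have := hD.measure_prefix e c
  rw [show (fun ω => digitPrefix e (D ω)) ⁻¹' {c} = {ω | digitPrefix e (D ω) = c} from rfl, this]
  simp [ENNReal.toReal_pow, ENNReal.toReal_inv]

lemma tendsto_cubePoint {d b : ℕ} [NeZero b] (hb : 2 ≤ b) (y : Fin d → ℕ → Fin b) :
    Tendsto (fun e => cubePoint (digitPrefix e y)) atTop (𝓝 (ofDigitsPoint y)) := by
  rw [tendsto_iff_dist_tendsto_zero]
  refine squeeze_zero (fun _ => dist_nonneg) (fun e => dist_cubePoint_le e y) ?_
  exact (tendsto_pow_atTop_atTop_of_one_lt (by exact_mod_cast hb)).inv_tendsto_atTop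

lemma HasUniformDigits.tendsto_cubeAverage {Ω : Type*} [MeasurableSpace Ω] {P : Measure Ω}
    [IsProbabilityMeasure P] {d b : ℕ} [NeZero b] (hb : 2 ≤ b) {D : Ω → Fin d → ℕ → Fin b}
    (hD : HasUniformDigits P D) (g : BoundedContinuousFunction (Fin d → I) ℝ) :
    Tendsto (fun e => cubeAverage b e g) atTop (𝓝 (∫ ω, g (ofDigitsPoint (D ω)) ∂P)) := by
  simp only [cubeAverage, ← hD.integral_digitPrefix fun c => g (cubePoint c)]
  refine tendsto_integral_of_dominated_convergence (fun _ => ‖g‖) (fun e => ?_)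
    (integrable_const _) (fun e => .of_forall fun ω => g.norm_coe_le_norm _)
    (.of_forall fun ω => (g.continuous.tendsto _).comp (tendsto_cubePoint hb (D ω)))
  exact ((measurable_of_countable fun c : Fin d → Fin e → Fin b => g (cubePoint c)).comp
    (measurable_digitPrefix.comp hD.measurable)).aestronglyMeasurable

/-- Integrals of bounded continuous functions are limits of `cubeAverage`, which does not see `D`;
hence prefix probabilities determine the law. -/
lemma HasUniformDigits.map_eq {Ω Ω' : Type*} [MeasurableSpace Ω] [MeasurableSpace Ω']
    {P : Measure Ω} {P' : Measure Ω'} [IsProbabilityMeasure P] [IsProbabilityMeasure P']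
    {d b : ℕ} [NeZero b] (hb : 2 ≤ b) {D : Ω → Fin d → ℕ → Fin b} {D' : Ω' → Fin d → ℕ → Fin b}
    (hD : HasUniformDigits P D) (hD' : HasUniformDigits P' D') :
    P.map (fun ω => ofDigitsPoint (D ω)) = P'.map fun ω => ofDigitsPoint (D' ω) := by
  have hm : Measurable fun ω => ofDigitsPoint (D ω) := measurable_ofDigitsPoint.comp hD.measurable
  have hm' : Measurable fun ω => ofDigitsPoint (D' ω) :=
    measurable_ofDigitsPoint.comp hD'.measurable
  have := Measure.isProbabilityMeasure_map (μ := P) hm.aemeasurable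
  have := Measure.isProbabilityMeasure_map (μ := P') hm'.aemeasurable
  refine ext_of_forall_integral_eq_of_IsFiniteMeasure fun g => ?_
  rw [integral_map hm.aemeasurable g.continuous.aestronglyMeasurable,
    integral_map hm'.aemeasurable g.continuous.aestronglyMeasurable]
  exact tendsto_nhds_unique (hD.tendsto_cubeAverage hb g) (hD'.tendsto_cubeAverage hb g)

lemma measurable_digits (b : ℕ) [NeZero b] : Measurable fun x : ℝ => Real.digits x b := by
  refine measurable_pi_lambda _ fun i => ?_
  exact (measurable_of_countable (Fin.ofNat b)).comp
    (Nat.measurable_floor.comp (measurable_id.mul_const _))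

lemma hasUniformDigits_pointDigits (d b : ℕ) [NeZero b] :
    HasUniformDigits (volume : Measure (Fin d → I))
      fun u => pointDigits b fun j => (u j : ℝ) where
  measurable := measurable_pi_lambda _ fun j =>
    (measurable_digits b).comp (measurable_subtype_coe.comp (measurable_pi_apply j))
  measure_prefix e c := by
    have hb : (0 : ℝ) < (b : ℝ) ^ e := pow_pos (Nat.cast_pos.2 (NeZero.pos b)) e
    have hcoord : ∀ j, volume {x : I | ∀ i < e, Real.digits (x : ℝ) b i = padDigits (c j) i} =
        (b : ℝ≥0∞)⁻¹ ^ e := by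
      intro j
      have hle : ((prefixValue (padDigits (c j)) e : ℝ) + 1) / (b : ℝ) ^ e ≤ 1 := by
        rw [div_le_one hb]
        exact_mod_cast prefixValue_lt (padDigits (c j)) e
      have hle' : (prefixValue (padDigits (c j)) e : ℝ) / (b : ℝ) ^ e ≤ 1 :=
        (by gcongr; linarith : _ ≤ _).trans hle
      have hae : {x : I | ∀ i < e, Real.digits (x : ℝ) b i = padDigits (c j) i} =ᵐ[volume]
          Set.Ico (⟨(prefixValue (padDigits (c j)) e : ℝ) / (b : ℝ) ^ e, by positivity, hle'⟩ : I)
            ⟨((prefixValue (padDigits (c j)) e : ℝ) + 1) / (b : ℝ) ^ e, by positivity, hle⟩ := by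
        -- The correspondence between digits and intervals is only available on `[0, 1)`.
        have h1 : ∀ᵐ x : I, x ≠ 1 := by
          simp [ae_iff]
        filter_upwards [h1] with x hx
        have hx' : (x : ℝ) ∈ Set.Ico (0 : ℝ) 1 :=
          ⟨x.2.1, lt_of_le_of_ne x.2.2 fun h => hx (Subtype.ext h)⟩
        exact propext (digits_eq_iff hx' _ e)
      rw [measure_congr hae, unitInterval.volume_Ico, ← sub_div, add_sub_cancel_left, one_div,
        ENNReal.ofReal_inv_of_pos hb, ENNReal.ofReal_pow (Nat.cast_nonneg b),
        ENNReal.ofReal_natCast, ENNReal.inv_pow]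
    have hset : {u : Fin d → I | digitPrefix e (pointDigits b fun j => (u j : ℝ)) = c} =
        Set.univ.pi fun j => {x : I | ∀ i < e, Real.digits (x : ℝ) b i = padDigits (c j) i} := by
      ext u
      simp [digitPrefix_eq_iff, pointDigits]
    rw [hset, volume_pi, Measure.pi_pi, Finset.prod_congr rfl fun j _ => hcoord j,
      Finset.prod_const, Finset.card_univ, Fintype.card_fin, ← pow_mul, mul_comm]

/-- Lebesgue measure itself has uniform digits, and expanding a point and reading the digits back
returns it unless some coordinate is `1`. -/
lemma map_ofDigitsPoint_eq_volume {Ω : Type*} [MeasurableSpace Ω] {P : Measure Ω}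
    [IsProbabilityMeasure P] {d b : ℕ} [NeZero b] (hb : 2 ≤ b) {D : Ω → Fin d → ℕ → Fin b}
    (hD : HasUniformDigits P D) : P.map (fun ω => ofDigitsPoint (D ω)) = volume := by
  rw [hD.map_eq hb (hasUniformDigits_pointDigits d b)]
  conv_rhs => rw [← Measure.map_id (μ := (volume : Measure (Fin d → I)))]
  refine Measure.map_congr ?_
  have h2 : ∀ᵐ u : Fin d → I, ∀ j, u j ≠ 1 :=
    ae_all_iff.2 fun j => Measure.ae_eval_ne (fun _ : Fin d => (volume : Measure I)) j 1
  filter_upwards [h2] with u hu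
  funext j
  exact Subtype.ext (Real.ofDigits_digits hb
    ⟨(u j).2.1, lt_of_le_of_ne (u j).2.2 fun h => hu j (Subtype.ext h)⟩)

lemma measurable_perm {b : ℕ} {α : Type*} [MeasurableSpace α] (F : Equiv.Perm (Fin b) → α) :
    Measurable F := fun _ _ => trivial

/-- The digit strings of the scramble of `x`, as a function of the permutations. -/
def scrambledDigits {d b : ℕ} [NeZero b] (x : Fin d → ℕ → Fin b)
    (p : Fin d × List (Fin b) → Equiv.Perm (Fin b)) : Fin d → ℕ → Fin b :=
  fun j => scrambleDigits (fun l => p (j, l)) (x j)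

lemma measurable_scrambledDigits {d b : ℕ} [NeZero b] (x : Fin d → ℕ → Fin b) :
    Measurable (scrambledDigits x) :=
  measurable_pi_lambda _ fun j => measurable_pi_lambda _ fun k =>
    (measurable_perm fun s : Equiv.Perm (Fin b) => s (x j k)).comp
      (measurable_pi_apply (j, List.ofFn fun i : Fin k => x j i))

/-- Composition with the transposition of `z` and `y` matches the fibres over `z` and `y`, so the
`b` fibres of `s ↦ s x` have equal size. -/
lemma card_perm_apply_eq {b : ℕ} (x y : Fin b) :
    b * Fintype.card {s : Equiv.Perm (Fin b) // s x = y} = Fintype.card (Equiv.Perm (Fin b)) := by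
  have h : ∀ z, Fintype.card {s : Equiv.Perm (Fin b) // s x = z} =
      Fintype.card {s : Equiv.Perm (Fin b) // s x = y} := fun z =>
    Fintype.card_congr ((Equiv.mulLeft (Equiv.swap z y)).subtypeEquiv fun s => by
      rw [Equiv.coe_mulLeft, Equiv.Perm.mul_apply, Equiv.swap_apply_eq_iff,
        Equiv.swap_apply_right])
  rw [← Fintype.card_congr (Equiv.sigmaFiberEquiv fun s : Equiv.Perm (Fin b) => s x),
    Fintype.card_sigma, Finset.sum_congr rfl fun z _ => h z]
  simp

section Scramble

variable {Ω : Type*} [MeasurableSpace Ω] {P : Measure Ω} {d b : ℕ}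
  {π : Fin d → List (Fin b) → Ω → Equiv.Perm (Fin b)}

lemma IsUniformScramble.measure_apply_eq (hπ : IsUniformScramble P π) (j : Fin d)
    (l : List (Fin b)) (x y : Fin b) : P {ω | π j l ω x = y} = (b : ℝ≥0∞)⁻¹ := by
  classical
  have hset : {ω | π j l ω x = y} =
      ⋃ ρ ∈ (Finset.univ.filter fun ρ : Equiv.Perm (Fin b) => ρ x = y), π j l ⁻¹' {ρ} := by
    ext ω
    simp
  have hb : (b : ℝ≥0∞) ≠ 0 := by exact_mod_cast x.pos.ne'
  have hcard : (b : ℝ≥0∞) * (Finset.univ.filter fun ρ : Equiv.Perm (Fin b) => ρ x = y).card =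
      Fintype.card (Equiv.Perm (Fin b)) := by
    rw [← card_perm_apply_eq x y, Nat.cast_mul, Fintype.card_subtype]
  rw [hset, measure_biUnion_finset (fun ρ _ ρ' _ h => Set.disjoint_left.2 fun ω h1 h2 =>
    h (h1.symm.trans h2)) fun ρ _ => hπ.measurable j l trivial]
  simp only [hπ.uniform, Finset.sum_const, nsmul_eq_mul]
  refine ENNReal.eq_inv_of_mul_eq_one_left ?_
  rw [mul_right_comm, mul_comm (Nat.cast _) (b : ℝ≥0∞), hcard]
  exact ENNReal.mul_inv_cancel (by exact_mod_cast Fintype.card_ne_zero) (ENNReal.natCast_ne_top _)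

lemma IsUniformScramble.hasUniformDigits [NeZero b] (hπ : IsUniformScramble P π)
    (x : Fin d → ℕ → Fin b) :
    HasUniformDigits P fun ω => scrambledDigits x fun i => π i.1 i.2 ω where
  measurable := (measurable_scrambledDigits x).comp
    (measurable_pi_lambda _ fun i => hπ.measurable i.1 i.2)
  measure_prefix e c := by
    -- The strings that index the permutations are unscrambled, hence deterministic, and have
    -- different lengths at different places. So distinct digits use distinct, independent
    -- permutations.
    let idx : Fin d × Fin e → Fin d × List (Fin b) := fun p =>
      (p.1, List.ofFn fun i : Fin p.2 => x p.1 i)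
    have hinj : Function.Injective idx := by
      rintro ⟨j, i⟩ ⟨j', i'⟩ h
      have h1 : j = j' := congrArg Prod.fst h
      have h2 := congrArg (fun q => q.2.length) h
      simp only [idx, List.length_ofFn] at h2
      exact Prod.ext h1 (Fin.ext h2)
    have hset : {ω | digitPrefix e (scrambledDigits x fun i => π i.1 i.2 ω) = c} =
        ⋂ p ∈ (Finset.univ : Finset (Fin d × Fin e)),
          (fun ω => π (idx p).1 (idx p).2 ω) ⁻¹' {s | s (x p.1 p.2) = c p.1 p.2} := by
      ext ω
      simp [funext_iff, digitPrefix, scrambledDigits, scrambleDigits, idx]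
    rw [hset, (hπ.indep.precomp hinj).measure_inter_preimage_eq_mul _ fun _ _ => trivial]
    refine (Finset.prod_congr rfl (g := fun _ => (b : ℝ≥0∞)⁻¹)
      fun p _ => hπ.measure_apply_eq (idx p).1 (idx p).2 _ _).trans ?_
    simp

end Scramble

/-! ### The law of large numbers for scrambled nets -/

/-- Bounds on the sums over consecutive blocks of length `B` bound all partial sums. -/
lemma abs_sum_range_le_of_blocks {u : ℕ → ℝ} {B : ℕ} (hB : 0 < B) {ε C : ℝ} (hε : 0 ≤ ε)
    (hC : ∀ n, |u n| ≤ C)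
    (hu : ∀ k, |∑ n ∈ Finset.Ico (k * B) ((k + 1) * B), u n| ≤ B * ε) (N : ℕ) :
    |∑ n ∈ Finset.range N, u n| ≤ N * ε + B * C := by
  have hblocks : ∀ M : ℕ, |∑ n ∈ Finset.range (M * B), u n| ≤ M * (B * ε) := by
    intro M
    induction M with
    | zero => simp
    | succ M ih =>
      rw [← Finset.sum_range_add_sum_Ico _ (Nat.mul_le_mul_right B M.le_succ)]
      calc _ ≤ _ := abs_add_le _ _
        _ ≤ M * (B * ε) + B * ε := add_le_add ih (hu M)
        _ = _ := by push_cast; ring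
  have hdiv : N / B * B ≤ N := Nat.div_mul_le_self N B
  have hC0 : 0 ≤ C := (abs_nonneg _).trans (hC 0)
  -- Complete blocks first, then a remainder of fewer than `B` terms, which accounts for `B * C`.
  rw [← Finset.sum_range_add_sum_Ico _ hdiv]
  refine (abs_add_le _ _).trans (add_le_add ((hblocks _).trans ?_) ?_)
  · rw [← mul_assoc]
    gcongr
    exact_mod_cast hdiv
  · calc _ ≤ ∑ n ∈ Finset.Ico (N / B * B) N, C :=
        (Finset.abs_sum_le_sum_abs _ _).trans (Finset.sum_le_sum fun n _ => hC n)
      _ = ((N - N / B * B : ℕ) : ℝ) * C := by simp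
      _ ≤ B * C := by
        gcongr
        have := Nat.mod_lt N hB
        rw [Nat.mod_eq_sub_div_mul] at this
        exact this.le

lemma exists_pow_inv_lt {b : ℕ} (hb : 2 ≤ b) {δ : ℝ} (hδ : 0 < δ) :
    ∃ e : ℕ, ((b : ℝ) ^ e)⁻¹ < δ := by
  have hb' : (1 : ℝ) < b := by exact_mod_cast hb
  obtain ⟨e, he⟩ := exists_pow_lt_of_lt_one hδ (inv_lt_one_of_one_lt₀ hb')
  exact ⟨e, by rwa [← inv_pow]⟩

/-- For continuous integrands the averages over scrambled nets converge uniformly in the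
scrambling permutations. -/
lemma IsTDSequence.exists_forall_abs_average_sub_integral_le {d b τ : ℕ} [NeZero b] (hb : 2 ≤ b)
    {a : ℕ → Fin d → ℝ} (ha : IsTDSequence b τ a) (g : BoundedContinuousFunction (Fin d → I) ℝ)
    {ε : ℝ} (hε : 0 < ε) :
    ∃ N₀ : ℕ, ∀ N ≥ N₀, ∀ ρ : Fin d → List (Fin b) → Equiv.Perm (Fin b),
      |(N : ℝ)⁻¹ * ∑ n ∈ Finset.range N, g (scramblePoint ρ (a n)) - ∫ q, g q| ≤ ε := by
  -- Budget: `ε / 4` for moving points to cube corners, `ε / 4` for comparing `∫ g` with the cube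
  -- average, `ε / 2` for the incomplete block once `N ≥ N₀`.
  obtain ⟨δ, hδ, hunif⟩ := Metric.uniformContinuous_iff.1
    (CompactSpace.uniformContinuous_of_continuous g.continuous) (ε / 4) (by positivity)
  obtain ⟨e, he⟩ := exists_pow_inv_lt hb hδ
  have hclose : ∀ y : Fin d → ℕ → Fin b,
      |g (ofDigitsPoint y) - g (cubePoint (digitPrefix e y))| ≤ ε / 4 := fun y => by
    rw [abs_sub_comm, ← Real.dist_eq]
    exact (hunif ((dist_cubePoint_le e y).trans_lt he)).le
  set A := cubeAverage b e g with hA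
  set B := b ^ (τ + d * e) with hB
  have hBpos : 0 < B := pow_pos (NeZero.pos b) _
  have hint : |(∫ q, g q) - A| ≤ ε / 4 := by
    have hD := hasUniformDigits_pointDigits d b
    have hm : Measurable fun u : Fin d → I => ofDigitsPoint (pointDigits b fun j => (u j : ℝ)) :=
      measurable_ofDigitsPoint.comp hD.measurable
    have hgm : Measurable fun u : Fin d → I =>
        g (cubePoint (digitPrefix e (pointDigits b fun j => (u j : ℝ)))) :=
      (measurable_of_countable fun c : Fin d → Fin e → Fin b => g (cubePoint c)).comp
        (measurable_digitPrefix.comp hD.measurable)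
    have h1 : ∫ q, g q = ∫ u : Fin d → I, g (ofDigitsPoint (pointDigits b fun j => (u j : ℝ))) := by
      conv_lhs => rw [← map_ofDigitsPoint_eq_volume hb hD]
      exact integral_map hm.aemeasurable g.continuous.aestronglyMeasurable
    have h2 : A = ∫ u : Fin d → I,
        g (cubePoint (digitPrefix e (pointDigits b fun j => (u j : ℝ)))) :=
      (hD.integral_digitPrefix fun c => g (cubePoint c)).symm
    rw [h1, h2, ← integral_sub]
    · rw [← Real.norm_eq_abs]
      exact (norm_integral_le_of_norm_le_const (C := ε / 4) (.of_forall fun u =>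
        hclose (pointDigits b fun j => (u j : ℝ)))).trans_eq (by simp)
    · exact .of_bound (g.continuous.measurable.comp hm).aestronglyMeasurable ‖g‖
        (.of_forall fun u => g.norm_coe_le_norm _)
    · exact .of_bound hgm.aestronglyMeasurable ‖g‖ (.of_forall fun u => g.norm_coe_le_norm _)
  obtain ⟨N₀, hN₀⟩ := exists_nat_gt (B * (‖g‖ + |A|) / (ε / 2))
  have hN₀pos : 0 < N₀ := by
    have : (0 : ℝ) < N₀ := lt_of_le_of_lt (by positivity) hN₀
    exact_mod_cast this
  refine ⟨N₀, fun N hN ρ => ?_⟩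
  have hNpos : (0 : ℝ) < N := by exact_mod_cast hN₀pos.trans_le hN
  have hsum := abs_sum_range_le_of_blocks (u := fun n => g (scramblePoint ρ (a n)) - A)
    (C := ‖g‖ + |A|) hBpos (by positivity : 0 ≤ ε / 4)
    (fun n => (abs_sub _ _).trans (add_le_add (g.norm_coe_le_norm _) le_rfl)) (fun k => by
      have hk := sum_block_cubePoint ha e k ρ g
      rw [← hA, ← hB] at hk
      have hBk : (b : ℝ) ^ (τ + d * e) * A = ∑ n ∈ Finset.Ico (k * B) ((k + 1) * B), A := by
        simp [hB, add_mul]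
      rw [hBk] at hk
      rw [Finset.sum_sub_distrib, ← hk, ← Finset.sum_sub_distrib]
      refine (Finset.abs_sum_le_sum_abs _ _).trans
        ((Finset.sum_le_sum fun n _ => hclose _).trans_eq ?_)
      simp [add_mul]) N
  have havg : (N : ℝ)⁻¹ * ∑ n ∈ Finset.range N, g (scramblePoint ρ (a n)) - ∫ q, g q =
      (N : ℝ)⁻¹ * ∑ n ∈ Finset.range N, (g (scramblePoint ρ (a n)) - A) - ((∫ q, g q) - A) := by
    simp only [Finset.sum_sub_distrib, Finset.sum_const, Finset.card_range, nsmul_eq_mul]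
    field_simp
    ring
  have hlarge : (N : ℝ)⁻¹ * (B * (‖g‖ + |A|)) ≤ ε / 2 := by
    have h3 : B * (‖g‖ + |A|) / (ε / 2) < N := hN₀.trans_le (by exact_mod_cast hN)
    rw [div_lt_iff₀ (by positivity)] at h3
    rw [inv_mul_le_iff₀ hNpos]
    exact h3.le
  rw [havg]
  refine (abs_sub _ _).trans ?_
  rw [abs_mul, abs_of_pos (inv_pos.2 hNpos)]
  have h4 := mul_le_mul_of_nonneg_left hsum (inv_pos.2 hNpos).le
  rw [mul_add, inv_mul_cancel_left₀ hNpos.ne'] at h4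
  linarith

section LawOfLargeNumbers

variable {Ω : Type*} [MeasurableSpace Ω] {P : Measure Ω} [IsProbabilityMeasure P] {d b : ℕ}
  [NeZero b] {π : Fin d → List (Fin b) → Ω → Equiv.Perm (Fin b)}

lemma IsUniformScramble.measurePreserving_scramblePoint (hb : 2 ≤ b)
    (hπ : IsUniformScramble P π) (x : Fin d → ℝ) :
    MeasurePreserving (fun ω => scramblePoint (fun j l => π j l ω) x) P volume :=
  ⟨measurable_ofDigitsPoint.comp (hπ.hasUniformDigits (pointDigits b x)).measurable,
    map_ofDigitsPoint_eq_volume hb (hπ.hasUniformDigits (pointDigits b x))⟩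

lemma IsUniformScramble.tendsto_integral_abs_average_sub (hb : 2 ≤ b)
    (hπ : IsUniformScramble P π) {τ : ℕ} {a : ℕ → Fin d → ℝ} (ha : IsTDSequence b τ a)
    {h : (Fin d → I) → ℝ} (hh : Integrable h) :
    Tendsto (fun N : ℕ => ∫ ω, |(N : ℝ)⁻¹ * ∑ n ∈ Finset.range N,
      h (scramblePoint (fun j l => π j l ω) (a n)) - ∫ q, h q| ∂P) atTop (𝓝 0) := by
  have hmp := fun n => hπ.measurePreserving_scramblePoint hb (a n)
  rw [Metric.tendsto_atTop]
  intro ε hε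
  obtain ⟨g, hg, hgi⟩ := hh.exists_boundedContinuous_integral_sub_le (ε := ε / 4) (by positivity)
  obtain ⟨N₀, hN₀⟩ := ha.exists_forall_abs_average_sub_integral_le hb g
    (ε := ε / 4) (by positivity)
  refine ⟨max N₀ 1, fun N hN => ?_⟩
  have hNpos : (0 : ℝ) < N := by exact_mod_cast (le_max_right N₀ 1).trans hN
  set q : ℕ → Ω → Fin d → I := fun n ω => scramblePoint (fun j l => π j l ω) (a n) with hq
  have hint : |(∫ q, g q) - ∫ q, h q| ≤ ε / 4 := by
    rw [abs_sub_comm, ← integral_sub hh hgi]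
    exact (norm_integral_le_integral_norm _).trans hg
  have hdiff : ∀ n, Integrable (fun ω => |h (q n ω) - g (q n ω)|) P := fun n =>
    ((hmp n).integrable_comp_of_integrable (hh.sub hgi)).abs
  have hdiff' : ∀ n, ∫ ω, |h (q n ω) - g (q n ω)| ∂P ≤ ε / 4 := fun n => by
    refine le_trans (le_of_eq ?_) hg
    conv_rhs => rw [← (hmp n).map_eq]
    rw [integral_map (hmp n).aemeasurable]
    · rfl
    · rw [(hmp n).map_eq]
      exact (hh.sub hgi).norm.aestronglyMeasurable
  -- Here `ε / 2` covers the uniform error for `g` and the gap between the two integrals. The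
  -- remaining sum is small only in expectation, at most `ε / 4` by uniformity of each point.
  have hpt : ∀ ω, |(N : ℝ)⁻¹ * ∑ n ∈ Finset.range N, h (q n ω) - ∫ q, h q| ≤
      (N : ℝ)⁻¹ * ∑ n ∈ Finset.range N, |h (q n ω) - g (q n ω)| + ε / 2 := fun ω => by
    have h1 := hN₀ N ((le_max_left N₀ 1).trans hN) fun j l => π j l ω
    have h2 : |(N : ℝ)⁻¹ * ∑ n ∈ Finset.range N, (h (q n ω) - g (q n ω))| ≤
        (N : ℝ)⁻¹ * ∑ n ∈ Finset.range N, |h (q n ω) - g (q n ω)| := by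
      rw [abs_mul, abs_of_pos (inv_pos.2 hNpos)]
      gcongr
      exact Finset.abs_sum_le_sum_abs _ _
    have h3 : (N : ℝ)⁻¹ * ∑ n ∈ Finset.range N, h (q n ω) - ∫ q, h q =
        (N : ℝ)⁻¹ * ∑ n ∈ Finset.range N, (h (q n ω) - g (q n ω)) +
        ((N : ℝ)⁻¹ * ∑ n ∈ Finset.range N, g (q n ω) - ∫ q, g q) + ((∫ q, g q) - ∫ q, h q) := by
      rw [Finset.sum_sub_distrib]
      ring
    rw [h3]
    refine (abs_add_le _ _).trans ((add_le_add (abs_add_le _ _) hint).trans ?_)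
    linarith
  have hint2 : Integrable (fun ω => (N : ℝ)⁻¹ * ∑ n ∈ Finset.range N,
      |h (q n ω) - g (q n ω)|) P := (integrable_finsetSum _ fun n _ => hdiff n).const_mul _
  rw [Real.dist_eq, sub_zero, abs_of_nonneg (integral_nonneg fun _ => abs_nonneg _)]
  calc _ ≤ ∫ ω, ((N : ℝ)⁻¹ * ∑ n ∈ Finset.range N, |h (q n ω) - g (q n ω)| + ε / 2) ∂P :=
        integral_mono_of_nonneg (.of_forall fun _ => abs_nonneg _)
          (hint2.add (integrable_const _)) (.of_forall hpt)
    _ = (N : ℝ)⁻¹ * ∑ n ∈ Finset.range N, ∫ ω, |h (q n ω) - g (q n ω)| ∂P + ε / 2 := by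
        rw [integral_add hint2 (integrable_const _), integral_const_mul,
          integral_finsetSum _ fun n _ => hdiff n]
        simp
    _ ≤ (N : ℝ)⁻¹ * ∑ n ∈ Finset.range N, ε / 4 + ε / 2 := by
        gcongr
        exact hdiff' _
    _ < ε := by
        rw [Finset.sum_const, Finset.card_range, nsmul_eq_mul, inv_mul_cancel_left₀ hNpos.ne']
        linarith

end LawOfLargeNumbers

/-! ### A conditional central limit theorem -/

/-- Factors are exchanged one at a time; all the others have norm at most one. -/
lemma norm_prod_sub_prod_le {ι : Type*} (s : Finset ι) (u v : ι → ℂ) (hu : ∀ i ∈ s, ‖u i‖ ≤ 1)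
    (hv : ∀ i ∈ s, ‖v i‖ ≤ 1) :
    ‖∏ i ∈ s, u i - ∏ i ∈ s, v i‖ ≤ ∑ i ∈ s, ‖u i - v i‖ := by
  classical
  induction s using Finset.induction_on with
  | empty => simp
  | insert i s hi ih =>
    rw [Finset.prod_insert hi, Finset.prod_insert hi, Finset.sum_insert hi]
    have hprod : ‖∏ k ∈ s, u k‖ ≤ 1 := by
      rw [norm_prod]
      exact Finset.prod_le_one (fun _ _ => norm_nonneg _)
        fun k hk => hu k (Finset.mem_insert_of_mem hk)
    have h := ih (fun k hk => hu k (Finset.mem_insert_of_mem hk))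
      fun k hk => hv k (Finset.mem_insert_of_mem hk)
    calc _ = ‖(u i - v i) * ∏ k ∈ s, u k + v i * (∏ k ∈ s, u k - ∏ k ∈ s, v k)‖ := by
          congr 1; ring
      _ ≤ ‖u i - v i‖ * ‖∏ k ∈ s, u k‖ + ‖v i‖ * ‖∏ k ∈ s, u k - ∏ k ∈ s, v k‖ := by
          rw [← norm_mul, ← norm_mul]
          exact norm_add_le _ _
      _ ≤ ‖u i - v i‖ * 1 + 1 * ‖∏ k ∈ s, u k - ∏ k ∈ s, v k‖ := by
          gcongr
          exact hv i (Finset.mem_insert_self i s)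
      _ ≤ _ := by rw [mul_one, one_mul]; gcongr

/-- Second order expansion of the characteristic function of a bounded centred random variable. -/
lemma norm_integral_cexp_sub_le {F : Type*} [MeasurableSpace F] {ν : Measure F}
    [IsProbabilityMeasure ν] {g : F → ℝ} (hg : Measurable g) {M : ℝ} (hM : ∀ x, |g x| ≤ M)
    (h0 : ∫ x, g x ∂ν = 0) {s : ℝ} (hs0 : 0 ≤ s) (hs1 : s ≤ 1) :
    ‖∫ x, Complex.exp ((s * g x : ℝ) * Complex.I) ∂ν -
        Complex.exp ((-(s ^ 2 / 2 * ∫ x, g x ^ 2 ∂ν) : ℝ))‖ ≤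
      (M ^ 3 * Real.exp M + M ^ 4 * Real.exp (M ^ 2)) * s ^ 3 := by
  have hM0 : 0 ≤ M := by
    obtain ⟨x⟩ := nonempty_of_isProbabilityMeasure ν
    exact (abs_nonneg _).trans (hM x)
  have hi1 : Integrable g ν := .of_bound hg.aestronglyMeasurable M (.of_forall hM)
  have hsq : ∀ x, g x ^ 2 ≤ M ^ 2 := fun x => sq_le_sq' (abs_le.1 (hM x)).1 (abs_le.1 (hM x)).2
  have hi2 : Integrable (fun x => g x ^ 2) ν :=
    .of_bound (hg.pow_const 2).aestronglyMeasurable (M ^ 2) (.of_forall fun x => by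
      rw [Real.norm_of_nonneg (sq_nonneg _)]
      exact hsq x)
  set V := ∫ x, g x ^ 2 ∂ν with hV
  have hV0 : 0 ≤ V := integral_nonneg fun _ => sq_nonneg _
  have hVM : V ≤ M ^ 2 := by
    refine (integral_mono hi2 (integrable_const (M ^ 2)) hsq).trans_eq (by simp)
  have hie : Integrable (fun x => Complex.exp ((s * g x : ℝ) * Complex.I)) ν :=
    .of_bound (by fun_prop) 1 (.of_forall fun x => (Complex.norm_exp_ofReal_mul_I _).le)
  have hit : Integrable (fun x => (1 + (s * g x : ℝ) * Complex.I -
      ((s ^ 2 / 2 * g x ^ 2 : ℝ) : ℂ))) ν :=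
    ((integrable_const _).add ((hi1.const_mul s).ofReal.mul_const _)).sub
      (hi2.const_mul _).ofReal
  have hT : ∫ x, (1 + (s * g x : ℝ) * Complex.I - ((s ^ 2 / 2 * g x ^ 2 : ℝ) : ℂ)) ∂ν =
      ((1 - s ^ 2 / 2 * V : ℝ) : ℂ) := by
    rw [integral_sub ((integrable_const _).add ((hi1.const_mul s).ofReal.mul_const _))
      (hi2.const_mul _).ofReal, integral_add (integrable_const _)
      ((hi1.const_mul s).ofReal.mul_const _), integral_mul_const,
      integral_complex_ofReal, integral_complex_ofReal, integral_const_mul, integral_const_mul, h0]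
    simp [hV]
  have hpt : ∀ x, ‖Complex.exp ((s * g x : ℝ) * Complex.I) -
      (1 + (s * g x : ℝ) * Complex.I - ((s ^ 2 / 2 * g x ^ 2 : ℝ) : ℂ))‖ ≤
        M ^ 3 * Real.exp M * s ^ 3 := fun x => by
    have h := Complex.norm_exp_sub_sum_le_norm_mul_exp ((s * g x : ℝ) * Complex.I) 3
    have hn : ‖((s * g x : ℝ) : ℂ) * Complex.I‖ ≤ M * s := by
      rw [norm_mul, Complex.norm_I, mul_one, Complex.norm_real, Real.norm_eq_abs, abs_mul,
        abs_of_nonneg hs0, mul_comm]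
      exact mul_le_mul_of_nonneg_right (hM x) hs0
    have hn' : M * s ≤ M := mul_le_of_le_one_right hM0 hs1
    have he : ∑ m ∈ Finset.range 3, (((s * g x : ℝ) : ℂ) * Complex.I) ^ m / m.factorial =
        1 + (s * g x : ℝ) * Complex.I - ((s ^ 2 / 2 * g x ^ 2 : ℝ) : ℂ) := by
      simp only [Finset.sum_range_succ, Finset.sum_range_zero, mul_pow, Complex.I_sq]
      push_cast
      simp [Nat.factorial]
      ring
    rw [he] at h
    calc _ ≤ _ := h
      _ ≤ (M * s) ^ 3 * Real.exp M := by
        gcongr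
        exact hn.trans hn'
      _ = _ := by ring
  have h1 : ‖∫ x, Complex.exp ((s * g x : ℝ) * Complex.I) ∂ν - ((1 - s ^ 2 / 2 * V : ℝ) : ℂ)‖ ≤
      M ^ 3 * Real.exp M * s ^ 3 := by
    rw [← hT, ← integral_sub hie hit]
    exact (norm_integral_le_of_norm_le_const (.of_forall hpt)).trans_eq (by simp)
  -- The Taylor remainder is of order `s ^ 4`; one factor `s ≤ 1` is dropped to match the cubic
  -- error above.
  have h2 : ‖Complex.exp ((-(s ^ 2 / 2 * V) : ℝ)) - ((1 - s ^ 2 / 2 * V : ℝ) : ℂ)‖ ≤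
      M ^ 4 * Real.exp (M ^ 2) * s ^ 3 := by
    have h := Complex.norm_exp_sub_sum_le_norm_mul_exp ((-(s ^ 2 / 2 * V) : ℝ)) 2
    have he : ∑ m ∈ Finset.range 2, (((-(s ^ 2 / 2 * V) : ℝ)) : ℂ) ^ m / m.factorial =
        ((1 - s ^ 2 / 2 * V : ℝ) : ℂ) := by
      simp [Finset.sum_range_succ, sub_eq_add_neg]
    have hx0 : 0 ≤ s ^ 2 / 2 * V := by positivity
    have hx1 : s ^ 2 / 2 * V ≤ s ^ 2 * M ^ 2 :=
      mul_le_mul (by nlinarith [sq_nonneg s]) hVM hV0 (sq_nonneg s)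
    have hs2 : s ^ 2 ≤ 1 := pow_le_one₀ hs0 hs1
    rw [he, Complex.norm_real, Real.norm_eq_abs, abs_neg, abs_of_nonneg hx0] at h
    calc _ ≤ _ := h
      _ ≤ (s ^ 2 * M ^ 2) ^ 2 * Real.exp (M ^ 2) := by
        gcongr
        exact hx1.trans (mul_le_of_le_one_left (sq_nonneg M) hs2)
      _ = s * (M ^ 4 * Real.exp (M ^ 2) * s ^ 3) := by ring
      _ ≤ _ := mul_le_of_le_one_left (by positivity) hs1
  calc _ = ‖(∫ x, Complex.exp ((s * g x : ℝ) * Complex.I) ∂ν - ((1 - s ^ 2 / 2 * V : ℝ) : ℂ)) -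
        (Complex.exp ((-(s ^ 2 / 2 * V) : ℝ)) - ((1 - s ^ 2 / 2 * V : ℝ) : ℂ))‖ := by
        congr 1; ring
    _ ≤ _ := (norm_sub_le _ _).trans (add_le_add h1 h2)
    _ = _ := by ring

lemma abs_exp_neg_sub_exp_neg_le {x y : ℝ} (hx : 0 ≤ x) (hy : 0 ≤ y) :
    |Real.exp (-x) - Real.exp (-y)| ≤ |x - y| := by
  wlog h : x ≤ y generalizing x y
  · rw [abs_sub_comm, abs_sub_comm x]
    exact this hy hx (le_of_not_ge h)
  have h1 : Real.exp (-y) ≤ Real.exp (-x) := Real.exp_le_exp.2 (neg_le_neg h)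
  rw [abs_of_nonneg (sub_nonneg.2 h1), abs_sub_comm, abs_of_nonneg (sub_nonneg.2 h)]
  have h2 : Real.exp (-y) = Real.exp (-x) * Real.exp (-(y - x)) := by
    rw [← Real.exp_add]; congr 1; ring
  have h3 := Real.add_one_le_exp (-(y - x))
  have h4 : Real.exp (-x) ≤ 1 := Real.exp_le_one_iff.2 (neg_nonpos.2 hx)
  nlinarith [Real.exp_pos (-x)]

section Conditional

variable {Ω E F : Type*} [MeasurableSpace Ω] [MeasurableSpace E] [MeasurableSpace F]
  {P : Measure Ω} [IsProbabilityMeasure P] {ν : Measure F}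
  {Q : ℕ → Ω → E} {X : ℕ → Ω → F}

/-- Fubini for a product of functions of independent variables, conditionally on `Q`. -/
lemma integral_prod_eq_integral_prod_integral (hQ : ∀ n, Measurable (Q n))
    (hX : ∀ n, Measurable (X n)) (hlaw : ∀ n, P.map (X n) = ν) (hindep : iIndepFun X P)
    (hQX : IndepFun (fun ω n => Q n ω) (fun ω n => X n ω) P) {G : E × F → ℂ}
    (hG : Measurable G) (hG1 : ∀ u, ‖G u‖ ≤ 1) (N : ℕ) :
    ∫ ω, ∏ n ∈ Finset.range N, G (Q n ω, X n ω) ∂P =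
      ∫ ω, ∏ n ∈ Finset.range N, ∫ x, G (Q n ω, x) ∂ν ∂P := by
  have hQm : Measurable fun ω n => Q n ω := measurable_pi_lambda _ hQ
  have hXm : Measurable fun ω n => X n ω := measurable_pi_lambda _ hX
  have := Measure.isProbabilityMeasure_map (μ := P) hQm.aemeasurable
  have := Measure.isProbabilityMeasure_map (μ := P) hXm.aemeasurable
  have hΨ : Measurable fun z : (ℕ → E) × (ℕ → F) => ∏ n ∈ Finset.range N, G (z.1 n, z.2 n) := by
    fun_prop
  have hΨ1 : ∀ z : (ℕ → E) × (ℕ → F), ‖∏ n ∈ Finset.range N, G (z.1 n, z.2 n)‖ ≤ 1 := fun z => by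
    rw [norm_prod]
    exact Finset.prod_le_one (fun _ _ => norm_nonneg _) fun _ _ => hG1 _
  have h1 : ∫ ω, ∏ n ∈ Finset.range N, G (Q n ω, X n ω) ∂P =
      ∫ z, ∏ n ∈ Finset.range N, G (z.1 n, z.2 n)
        ∂(P.map fun ω => ((fun n => Q n ω), fun n => X n ω)) :=
    (integral_map (hQm.prodMk hXm).aemeasurable hΨ.aestronglyMeasurable).symm
  have hinner : Measurable fun p : ℕ → E =>
      ∫ x, ∏ n ∈ Finset.range N, G (p n, x n) ∂(P.map fun ω n => X n ω) :=
    (hΨ.stronglyMeasurable.integral_prod_right).measurable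
  -- Independence makes the joint law a product, so `Q` can be frozen and independence of the `X n`
  -- factors the inner integral.
  rw [h1, (indepFun_iff_map_prod_eq_prod_map_map hQm.aemeasurable hXm.aemeasurable).1 hQX,
    integral_prod _ (.of_bound hΨ.aestronglyMeasurable 1 (.of_forall hΨ1)),
    integral_map hQm.aemeasurable hinner.aestronglyMeasurable]
  refine integral_congr_ae (.of_forall fun ω => ?_)
  have hGs : ∀ q, Measurable fun x => G (q, x) := fun q => hG.comp measurable_prodMk_left
  have h2 : ∫ x, ∏ n ∈ Finset.range N, G (Q n ω, x n) ∂(P.map fun ω' n => X n ω') =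
      ∫ ω', ∏ n ∈ Finset.range N, G (Q n ω, X n ω') ∂P :=
    integral_map hXm.aemeasurable
      (hΨ.comp (measurable_prodMk_left (x := fun n => Q n ω))).aestronglyMeasurable
  refine h2.trans ?_
  simp only [Finset.prod_range]
  rw [(hindep.precomp Fin.val_injective).integral_fun_prod_comp
    (f := fun (n : Fin N) x => G (Q n ω, x)) (fun n => (hX n).aemeasurable)
    fun n => (hGs _).aestronglyMeasurable]
  refine Finset.prod_congr rfl fun n _ => ?_
  rw [← hlaw n, integral_map (hX n).aemeasurable (hGs _).aestronglyMeasurable]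

/-- If the averaged conditional variances converge in `L¹`, the characteristic functions of the
normalized sums converge to that of a normal distribution. -/
lemma tendsto_integral_cexp_sum [IsProbabilityMeasure ν] (hQ : ∀ n, Measurable (Q n))
    (hX : ∀ n, Measurable (X n)) (hlaw : ∀ n, P.map (X n) = ν) (hindep : iIndepFun X P)
    (hQX : IndepFun (fun ω n => Q n ω) (fun ω n => X n ω) P) {g : E × F → ℝ}
    (hg : Measurable g) {M : ℝ} (hM : ∀ u, |g u| ≤ M) (h0 : ∀ q, ∫ x, g (q, x) ∂ν = 0)
    {V : ℝ} (hV : 0 ≤ V)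
    (hlim : Tendsto (fun N : ℕ => ∫ ω, |(N : ℝ)⁻¹ * ∑ n ∈ Finset.range N,
      (∫ x, g (Q n ω, x) ^ 2 ∂ν) - V| ∂P) atTop (𝓝 0)) :
    Tendsto (fun N : ℕ => ∫ ω, Complex.exp (((√N)⁻¹ * ∑ n ∈ Finset.range N, g (Q n ω, X n ω) : ℝ) *
      Complex.I) ∂P) atTop (𝓝 (Complex.exp ((-(V / 2) : ℝ)))) := by
  set K := M ^ 3 * Real.exp M + M ^ 4 * Real.exp (M ^ 2) with hK
  have hvm : Measurable fun q => ∫ x, g (q, x) ^ 2 ∂ν :=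
    ((hg.pow_const 2).stronglyMeasurable.integral_prod_right (ν := ν)).measurable
  have hv0 : ∀ q, 0 ≤ ∫ x, g (q, x) ^ 2 ∂ν := fun q => integral_nonneg fun _ => sq_nonneg _
  have hvM : ∀ q, ∫ x, g (q, x) ^ 2 ∂ν ≤ M ^ 2 := fun q => by
    have h := norm_integral_le_of_norm_le_const (μ := ν) (f := fun x => g (q, x) ^ 2) (C := M ^ 2)
      (.of_forall fun x => by
        rw [Real.norm_eq_abs, abs_pow]
        exact pow_le_pow_left₀ (abs_nonneg _) (hM _) 2)
    simpa using (le_abs_self _).trans h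
  set A : ℕ → Ω → ℝ := fun N ω => (N : ℝ)⁻¹ * ∑ n ∈ Finset.range N, ∫ x, g (Q n ω, x) ^ 2 ∂ν
    with hA
  have hAm : ∀ N, Measurable (A N) := fun N =>
    (Finset.measurable_sum _ fun n _ => hvm.comp (hQ n)).const_mul _
  have hA0 : ∀ N ω, 0 ≤ A N ω := fun N ω =>
    mul_nonneg (by positivity) (Finset.sum_nonneg fun n _ => hv0 _)
  have hAM : ∀ N ω, A N ω ≤ M ^ 2 := fun N ω => by
    rcases Nat.eq_zero_or_pos N with rfl | hN
    · simp [hA, sq_nonneg]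
    have hN' : (0 : ℝ) < N := by exact_mod_cast hN
    rw [hA, inv_mul_le_iff₀ hN']
    exact (Finset.sum_le_sum fun n _ => hvM (Q n ω)).trans_eq (by simp)
  have hbound : ∀ N : ℕ, 1 ≤ N →
      ‖∫ ω, Complex.exp (((√N)⁻¹ * ∑ n ∈ Finset.range N, g (Q n ω, X n ω) : ℝ) * Complex.I) ∂P -
        Complex.exp ((-(V / 2) : ℝ))‖ ≤ K * (√N)⁻¹ + ∫ ω, |A N ω - V| ∂P := by
    intro N hN
    have hNpos : (0 : ℝ) < N := by exact_mod_cast hN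
    set s := (√(N : ℝ))⁻¹ with hs
    have hs0 : 0 ≤ s := by positivity
    have hs1 : s ≤ 1 := inv_le_one_of_one_le₀ (Real.one_le_sqrt.2 (by exact_mod_cast hN))
    have hs2 : s ^ 2 = (N : ℝ)⁻¹ := by rw [hs, inv_pow, Real.sq_sqrt hNpos.le]
    have hfub : ∫ ω, Complex.exp ((s * ∑ n ∈ Finset.range N, g (Q n ω, X n ω) : ℝ) *
        Complex.I) ∂P = ∫ ω, ∏ n ∈ Finset.range N,
          ∫ x, Complex.exp ((s * g (Q n ω, x) : ℝ) * Complex.I) ∂ν ∂P := by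
      rw [← integral_prod_eq_integral_prod_integral hQ hX hlaw hindep hQX
        (G := fun u => Complex.exp ((s * g u : ℝ) * Complex.I)) (by fun_prop)
        (fun u => (Complex.norm_exp_ofReal_mul_I _).le) N]
      refine integral_congr_ae (.of_forall fun ω => ?_)
      simp only [← Complex.exp_sum]
      rw [← Finset.sum_mul, ← Complex.ofReal_sum, ← Finset.mul_sum]
    have hφm : Measurable fun ω => ∏ n ∈ Finset.range N,
        ∫ x, Complex.exp ((s * g (Q n ω, x) : ℝ) * Complex.I) ∂ν := by
      have h : Measurable fun u => Complex.exp ((s * g u : ℝ) * Complex.I) := by fun_prop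
      have h' : Measurable fun q => ∫ x, Complex.exp ((s * g (q, x) : ℝ) * Complex.I) ∂ν :=
        (h.stronglyMeasurable.integral_prod_right (ν := ν)).measurable
      exact Finset.measurable_prod _ fun n _ => h'.comp (hQ n)
    have hφ1 : ∀ q, ‖∫ x, Complex.exp ((s * g (q, x) : ℝ) * Complex.I) ∂ν‖ ≤ 1 := fun q =>
      (norm_integral_le_of_norm_le_const (C := 1)
        (.of_forall fun x => (Complex.norm_exp_ofReal_mul_I _).le)).trans_eq (by simp)
    have hprod : ∀ ω, ‖∏ n ∈ Finset.range N,
        ∫ x, Complex.exp ((s * g (Q n ω, x) : ℝ) * Complex.I) ∂ν -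
          Complex.exp ((-(A N ω / 2) : ℝ))‖ ≤ K * s := fun ω => by
      have hexp : Complex.exp ((-(A N ω / 2) : ℝ)) = ∏ n ∈ Finset.range N,
          Complex.exp ((-(s ^ 2 / 2 * ∫ x, g (Q n ω, x) ^ 2 ∂ν) : ℝ)) := by
        rw [← Complex.exp_sum, ← Complex.ofReal_sum, Finset.sum_neg_distrib, ← Finset.mul_sum, hs2,
          hA]
        congr 3
        ring
      rw [hexp]
      refine (norm_prod_sub_prod_le _ _ _ (fun n _ => hφ1 _) fun n _ => ?_).trans ?_
      · rw [← Complex.ofReal_exp, Complex.norm_real, Real.norm_of_nonneg (Real.exp_pos _).le]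
        exact Real.exp_le_one_iff.2 (neg_nonpos.2 (mul_nonneg (by positivity) (hv0 _)))
      · refine (Finset.sum_le_sum fun n _ => norm_integral_cexp_sub_le
          (hg.comp measurable_prodMk_left) (fun x => hM _) (h0 _) hs0 hs1).trans_eq ?_
        -- There are `N` errors `K * s ^ 3`, and `N * s ^ 2 = 1`.
        rw [Finset.sum_const, Finset.card_range, nsmul_eq_mul, pow_succ s 2, hs2, ← hK]
        field_simp
    have hpt : ∀ ω, ‖∏ n ∈ Finset.range N,
        ∫ x, Complex.exp ((s * g (Q n ω, x) : ℝ) * Complex.I) ∂ν -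
          Complex.exp ((-(V / 2) : ℝ))‖ ≤ K * s + |A N ω - V| := fun ω => by
      have h : ‖Complex.exp ((-(A N ω / 2) : ℝ)) - Complex.exp ((-(V / 2) : ℝ))‖ ≤
          |A N ω - V| := by
        rw [← Complex.ofReal_exp, ← Complex.ofReal_exp, ← Complex.ofReal_sub, Complex.norm_real,
          Real.norm_eq_abs]
        refine (abs_exp_neg_sub_exp_neg_le (div_nonneg (hA0 N ω) zero_le_two)
          (div_nonneg hV zero_le_two)).trans ?_
        rw [← sub_div, abs_div, abs_two]
        exact half_le_self (abs_nonneg _)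
      exact (norm_sub_le_norm_sub_add_norm_sub _ _ _).trans (add_le_add (hprod ω) h)
    have hAi : Integrable (fun ω => |A N ω - V|) P := by
      refine ((Integrable.of_bound (hAm N).aestronglyMeasurable (M ^ 2) (.of_forall fun ω => ?_)).sub
        (integrable_const V)).abs
      rw [Real.norm_of_nonneg (hA0 N ω)]
      exact hAM N ω
    have hφi : Integrable (fun ω => ∏ n ∈ Finset.range N,
        ∫ x, Complex.exp ((s * g (Q n ω, x) : ℝ) * Complex.I) ∂ν) P :=
      .of_bound hφm.aestronglyMeasurable 1 (.of_forall fun ω => by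
        rw [norm_prod]
        exact Finset.prod_le_one (fun _ _ => norm_nonneg _) fun _ _ => hφ1 _)
    have hconst : Complex.exp ((-(V / 2) : ℝ)) = ∫ _, Complex.exp ((-(V / 2) : ℝ)) ∂P := by simp
    rw [hfub, hconst, ← integral_sub hφi (integrable_const _)]
    refine (norm_integral_le_of_norm_le ((integrable_const (K * s)).add hAi)
      (.of_forall hpt)).trans_eq ?_
    simp only [Pi.add_apply]
    rw [integral_add (integrable_const _) hAi]
    simp
  rw [tendsto_iff_norm_sub_tendsto_zero]
  refine squeeze_zero' (.of_forall fun _ => norm_nonneg _)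
    ((eventually_ge_atTop 1).mono hbound) ?_
  have hsqrt : Tendsto (fun N : ℕ => (√(N : ℝ))⁻¹) atTop (𝓝 0) :=
    (Real.tendsto_sqrt_atTop.comp tendsto_natCast_atTop_atTop).inv_tendsto_atTop
  simpa using (hsqrt.const_mul K).add hlim

end Conditional

/-! ### The asymptotic covariance -/

section Covariance

variable {d r t : ℕ} {f : (Fin d → I) × (Fin r → I) → EuclideanSpace ℝ (Fin t)}

/-- The centred integrand in the direction `ξ`. -/
noncomputable def centredInner (f : (Fin d → I) × (Fin r → I) → EuclideanSpace ℝ (Fin t))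
    (ξ : EuclideanSpace ℝ (Fin t)) (u : (Fin d → I) × (Fin r → I)) : ℝ :=
  inner ℝ (f u - partialMean f u.1) ξ

lemma measurable_partialMean (hf : Measurable f) : Measurable (partialMean f) :=
  (hf.stronglyMeasurable.integral_prod_right' (ν := volume)).measurable

lemma norm_partialMean_le {C : ℝ} (hC : ∀ u, ‖f u‖ ≤ C) (q : Fin d → I) :
    ‖partialMean f q‖ ≤ C :=
  (norm_integral_le_of_norm_le_const (.of_forall fun x => hC (q, x))).trans_eq (by simp)

lemma measurable_centredInner (hf : Measurable f) (ξ : EuclideanSpace ℝ (Fin t)) :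
    Measurable (centredInner f ξ) :=
  (hf.sub ((measurable_partialMean hf).comp measurable_fst)).inner measurable_const

lemma abs_centredInner_le {C : ℝ} (hC : ∀ u, ‖f u‖ ≤ C) (ξ : EuclideanSpace ℝ (Fin t))
    (u : (Fin d → I) × (Fin r → I)) : |centredInner f ξ u| ≤ (C + C) * ‖ξ‖ :=
  (abs_real_inner_le_norm _ _).trans <| mul_le_mul_of_nonneg_right
    ((norm_sub_le _ _).trans (add_le_add (hC u) (norm_partialMean_le hC _))) (norm_nonneg _)

lemma integrable_section (hf : Measurable f) {C : ℝ} (hC : ∀ u, ‖f u‖ ≤ C) (q : Fin d → I) :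
    Integrable fun x => f (q, x) :=
  .of_bound (hf.comp measurable_prodMk_left).aestronglyMeasurable C (.of_forall fun _ => hC _)

lemma integral_inner_section (hf : Measurable f) {C : ℝ} (hC : ∀ u, ‖f u‖ ≤ C)
    (ξ : EuclideanSpace ℝ (Fin t)) (q : Fin d → I) :
    ∫ x, inner ℝ (f (q, x)) ξ = inner ℝ (partialMean f q) ξ := by
  simp only [real_inner_comm ξ]
  exact integral_inner (integrable_section hf hC q) ξ

lemma integral_centredInner (hf : Measurable f) {C : ℝ} (hC : ∀ u, ‖f u‖ ≤ C)
    (ξ : EuclideanSpace ℝ (Fin t)) (q : Fin d → I) : ∫ x, centredInner f ξ (q, x) = 0 := by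
  simp only [centredInner, inner_sub_left]
  rw [integral_sub ((integrable_section hf hC q).inner_const ξ) (integrable_const _),
    integral_inner_section hf hC]
  simp

lemma inner_sq_eq_sum (v ξ : EuclideanSpace ℝ (Fin t)) :
    inner ℝ v ξ ^ 2 = ∑ i, ∑ j, ξ i * ξ j * (v i * v j) := by
  rw [PiLp.inner_apply, sq, Finset.sum_mul_sum]
  refine Finset.sum_congr rfl fun i _ => Finset.sum_congr rfl fun j _ => ?_
  simp only [RCLike.inner_apply, conj_trivial]
  ring

lemma integral_inner_sq {α : Type*} [MeasurableSpace α] {ν : Measure α} [IsFiniteMeasure ν]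
    {h : α → EuclideanSpace ℝ (Fin t)} (hh : Measurable h) {C : ℝ} (hC : ∀ u, ‖h u‖ ≤ C)
    (ξ : EuclideanSpace ℝ (Fin t)) :
    ∫ u, inner ℝ (h u) ξ ^ 2 ∂ν = ∑ i, ∑ j, ξ i * ξ j * ∫ u, h u i * h u j ∂ν := by
  have hm : ∀ i, Measurable fun u => h u i := fun i => by fun_prop
  have hcoord : ∀ i u, ‖h u i‖ ≤ C := fun i u => (PiLp.norm_apply_le (h u) i).trans (hC u)
  have hint : ∀ i j, Integrable (fun u => ξ i * ξ j * (h u i * h u j)) ν := fun i j =>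
    (Integrable.of_bound ((hm i).mul (hm j)).aestronglyMeasurable (C * C)
      (.of_forall fun u => by
        rw [Pi.mul_apply, norm_mul]
        exact mul_le_mul (hcoord i u) (hcoord j u) (norm_nonneg _)
          ((norm_nonneg _).trans (hcoord i u)))).const_mul _
  simp only [inner_sq_eq_sum]
  rw [integral_finsetSum _ fun i _ => integrable_finsetSum _ fun j _ => hint i j]
  refine Finset.sum_congr rfl fun i _ => ?_
  rw [integral_finsetSum _ fun j _ => hint i j]
  exact Finset.sum_congr rfl fun j _ => integral_const_mul _ _

/-- The quadratic form of the covariance matrix is the expected conditional variance. -/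
lemma dotProduct_mixedCovariance_mulVec (hf : Measurable f) {C : ℝ} (hC : ∀ u, ‖f u‖ ≤ C)
    (ξ : EuclideanSpace ℝ (Fin t)) :
    ξ.ofLp ⬝ᵥ (mixedCovariance f).mulVec ξ.ofLp =
      ∫ q : Fin d → I, ∫ x : Fin r → I, centredInner f ξ (q, x) ^ 2 := by
  have hmean := measurable_partialMean hf
  have hsqm : Measurable fun u => inner ℝ (f u) ξ ^ 2 := (hf.inner measurable_const).pow_const 2
  have hsqb : ∀ (v : EuclideanSpace ℝ (Fin t)), ‖v‖ ≤ C → ‖inner ℝ v ξ ^ 2‖ ≤ (C * ‖ξ‖) ^ 2 :=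
    fun v hv => by
      rw [norm_pow]
      gcongr
      exact (norm_inner_le_norm v ξ).trans (by gcongr)
  have hsq : Integrable fun u => inner ℝ (f u) ξ ^ 2 :=
    .of_bound hsqm.aestronglyMeasurable _ (.of_forall fun u => hsqb _ (hC u))
  have hsec : ∀ q, Integrable fun x => inner ℝ (f (q, x)) ξ ^ 2 := fun q =>
    .of_bound (hsqm.comp measurable_prodMk_left).aestronglyMeasurable _
      (.of_forall fun x => hsqb _ (hC _))
  have hmeansq : Integrable fun q => inner ℝ (partialMean f q) ξ ^ 2 :=
    .of_bound ((hmean.inner measurable_const).pow_const 2).aestronglyMeasurable _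
      (.of_forall fun q => hsqb _ (norm_partialMean_le hC q))
  -- Second moment minus squared mean, for each fixed `q`.
  have hvar : ∀ q, ∫ x, centredInner f ξ (q, x) ^ 2 =
      (∫ x, inner ℝ (f (q, x)) ξ ^ 2) - inner ℝ (partialMean f q) ξ ^ 2 := fun q => by
    have h1 : ∀ x, centredInner f ξ (q, x) ^ 2 = inner ℝ (f (q, x)) ξ ^ 2 -
        2 * inner ℝ (partialMean f q) ξ * inner ℝ (f (q, x)) ξ +
          inner ℝ (partialMean f q) ξ ^ 2 := fun x => by
      rw [centredInner, inner_sub_left]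
      ring
    have h2 := ((integrable_section hf hC q).inner_const ξ).const_mul
      (2 * inner ℝ (partialMean f q) ξ)
    have h3 : Integrable fun x => inner ℝ (f (q, x)) ξ ^ 2 -
      2 * inner ℝ (partialMean f q) ξ * inner ℝ (f (q, x)) ξ := (hsec q).sub h2
    simp only [h1]
    rw [integral_add h3 (integrable_const _), integral_sub (hsec q) h2,
      integral_const_mul, integral_inner_section hf hC]
    simp
    ring
  rw [Measure.volume_eq_prod] at hsq
  have hfub : Integrable fun q : Fin d → I => ∫ x : Fin r → I, inner ℝ (f (q, x)) ξ ^ 2 :=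
    hsq.integral_prod_left
  simp only [hvar]
  rw [integral_sub hfub hmeansq, ← integral_prod _ hsq,
    ← Measure.volume_eq_prod, integral_inner_sq hf hC,
    integral_inner_sq hmean (norm_partialMean_le hC), ← Finset.sum_sub_distrib]
  simp only [dotProduct, Matrix.mulVec, Finset.mul_sum, mixedCovariance, Matrix.of_apply]
  refine Finset.sum_congr rfl fun i _ => ?_
  rw [← Finset.sum_sub_distrib]
  refine Finset.sum_congr rfl fun j _ => ?_
  ring

lemma integral_integral_centredInner_sq_nonneg (ξ : EuclideanSpace ℝ (Fin t)) :
    0 ≤ ∫ q : Fin d → I, ∫ x : Fin r → I, centredInner f ξ (q, x) ^ 2 :=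
  integral_nonneg fun _ => integral_nonneg fun _ => sq_nonneg _

lemma posSemidef_mixedCovariance (hf : Measurable f) {C : ℝ} (hC : ∀ u, ‖f u‖ ≤ C) :
    (mixedCovariance f).PosSemidef := by
  refine .of_dotProduct_mulVec_nonneg ?_ fun ξ => ?_
  · ext i j
    simp [mixedCovariance, mul_comm]
  · have h := dotProduct_mixedCovariance_mulVec hf hC (WithLp.toLp 2 ξ)
    rw [star_trivial]
    exact h ▸ integral_integral_centredInner_sq_nonneg _

lemma inner_sqrt_smul_centredMean (ξ : EuclideanSpace ℝ (Fin t)) (q : ℕ → Fin d → I)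
    (x : ℕ → Fin r → I) (N : ℕ) :
    inner ℝ (√(N : ℝ) • centredMean f q x N) ξ =
      (√(N : ℝ))⁻¹ * ∑ n ∈ Finset.range N, centredInner f ξ (q n, x n) := by
  -- Also valid for `N = 0`, where both sides are zero.
  have h : √(N : ℝ) * (N : ℝ)⁻¹ = (√(N : ℝ))⁻¹ := by
    rw [← div_eq_mul_inv, Real.sqrt_div_self]
  rw [centredMean, smul_smul, h, real_inner_smul_left, ← Finset.sum_sub_distrib, sum_inner]
  rfl

end Covariance

/-! ### Measurable integrands -/

section Main

variable {Ω : Type*} [MeasurableSpace Ω] {P : Measure Ω} {d r t b τ : ℕ} [NeZero b] {a : ℕ → Fin d → ℝ}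
  {π : Fin d → List (Fin b) → Ω → Equiv.Perm (Fin b)} {X : ℕ → Ω → Fin r → I}
  {f : (Fin d → I) × (Fin r → I) → EuclideanSpace ℝ (Fin t)}

lemma indepFun_scramblePoint
    (hπX : IndepFun (fun ω (i : Fin d × List (Fin b)) => π i.1 i.2 ω) (fun ω n => X n ω) P) :
    IndepFun (fun ω n => scramblePoint (fun j l => π j l ω) (a n)) (fun ω n => X n ω) P := by
  have hφ : Measurable fun (p : Fin d × List (Fin b) → Equiv.Perm (Fin b)) (n : ℕ) =>
      ofDigitsPoint (scrambledDigits (pointDigits b (a n)) p) :=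
    measurable_pi_lambda _ fun n => measurable_ofDigitsPoint.comp (measurable_scrambledDigits _)
  exact hπX.comp hφ measurable_id

lemma measurable_sqrt_smul_centredMean (hf : Measurable f) {Q : ℕ → Ω → Fin d → I}
    (hQ : ∀ n, Measurable (Q n)) (hX : ∀ n, Measurable (X n)) (N : ℕ) :
    Measurable fun ω => √(N : ℝ) • centredMean f (fun n => Q n ω) (fun n => X n ω) N := by
  have hmean := measurable_partialMean hf
  unfold centredMean
  have h1 : Measurable fun ω => ∑ n ∈ Finset.range N, f (Q n ω, X n ω) :=
    Finset.measurable_sum _ fun n _ => hf.comp ((hQ n).prodMk (hX n))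
  have h2 : Measurable fun ω => ∑ n ∈ Finset.range N, partialMean f (Q n ω) :=
    Finset.measurable_sum _ fun n _ => hmean.comp (hQ n)
  exact ((h1.sub h2).const_smul (N : ℝ)⁻¹).const_smul √(N : ℝ)

/-- By Lévy's theorem it suffices to treat one `ξ` at a time, which is the scalar conditional limit
theorem for `centredInner f ξ`, fed by the law of large numbers for its conditional variance. -/
lemma tendstoInDistribution_of_measurable [IsProbabilityMeasure P] (hb : 2 ≤ b) (ha : IsTDSequence b τ a)
    (hπ : IsUniformScramble P π) (hX_meas : ∀ n, Measurable (X n))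
    (hX_law : ∀ n, P.map (X n) = volume) (hX_indep : iIndepFun X P)
    (hπX : IndepFun (fun ω (i : Fin d × List (Fin b)) => π i.1 i.2 ω) (fun ω n => X n ω) P)
    (hf : Measurable f) {C : ℝ} (hC : ∀ u, ‖f u‖ ≤ C) :
    TendstoInDistribution
      (fun (N : ℕ) (ω : Ω) => √(N : ℝ) •
        centredMean f (fun n => scramblePoint (fun j l => π j l ω) (a n)) (fun n => X n ω) N)
      atTop (id : EuclideanSpace ℝ (Fin t) → EuclideanSpace ℝ (Fin t)) (fun _ => P)
      (multivariateGaussian 0 (mixedCovariance f)) := by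
  have hQ := fun n => (hπ.measurePreserving_scramblePoint hb (a n)).measurable
  have hm := measurable_sqrt_smul_centredMean hf hQ hX_meas
  refine ⟨fun N => (hm N).aemeasurable, aemeasurable_id,
    ProbabilityMeasure.tendsto_iff_tendsto_charFun.2 fun ξ => ?_⟩
  have hvi : Integrable fun q : Fin d → I => ∫ x : Fin r → I, centredInner f ξ (q, x) ^ 2 := by
    refine Integrable.integral_prod_left (f := fun u => centredInner f ξ u ^ 2) (.of_bound
      ((measurable_centredInner hf ξ).pow_const 2).aestronglyMeasurable (((C + C) * ‖ξ‖) ^ 2)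
      (.of_forall fun u => ?_))
    rw [norm_pow]
    exact pow_le_pow_left₀ (norm_nonneg _) (abs_centredInner_le hC ξ u) 2
  set Q : ℕ → Ω → Fin d → I := fun n ω => scramblePoint (fun j l => π j l ω) (a n)
  have hlln := hπ.tendsto_integral_abs_average_sub hb ha hvi
  have hlim := tendsto_integral_cexp_sum (Q := Q) (g := centredInner f ξ) hQ hX_meas hX_law
    hX_indep (indepFun_scramblePoint hπX) (measurable_centredInner hf ξ)
    (abs_centredInner_le hC ξ) (integral_centredInner hf hC ξ)
    (integral_integral_centredInner_sq_nonneg (f := f) ξ) hlln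
  have hleft : ∀ N : ℕ, charFun (P.map fun ω => √(N : ℝ) •
      centredMean f (fun n => Q n ω) (fun n => X n ω) N) ξ =
      ∫ ω, Complex.exp (((√(N : ℝ))⁻¹ * ∑ n ∈ Finset.range N,
        centredInner f ξ (Q n ω, X n ω) : ℝ) * Complex.I) ∂P := fun N => by
    rw [charFun_apply, integral_map (hm N).aemeasurable (by fun_prop)]
    simp only [inner_sqrt_smul_centredMean, Q]
  have hright : charFun ((multivariateGaussian 0 (mixedCovariance f)).map id) ξ =
      Complex.exp ((-((∫ q : Fin d → I, ∫ x : Fin r → I,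
        centredInner f ξ (q, x) ^ 2) / 2) : ℝ)) := by
    rw [Measure.map_id, charFun_multivariateGaussian (posSemidef_mixedCovariance hf hC),
      dotProduct_mixedCovariance_mulVec hf hC]
    simp
  rw [ProbabilityMeasure.coe_mk, hright]
  exact hlim.congr fun N => (hleft N).symm

end Main

/-! ### Replacing the integrand by a measurable one -/

section Congr

variable {Ω : Type*} [MeasurableSpace Ω] {P : Measure Ω} [IsProbabilityMeasure P]
  {d r t : ℕ} {f g : (Fin d → I) × (Fin r → I) → EuclideanSpace ℝ (Fin t)}

/-- A measurable representative may exceed `C` on a null set; setting it to zero there keeps the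
bound everywhere, so every section is bounded and integrable. -/
lemma exists_measurable_bounded_ae_eq (hf : AEStronglyMeasurable f) {C : ℝ}
    (hC : ∀ u, ‖f u‖ ≤ C) : ∃ g : (Fin d → I) × (Fin r → I) → EuclideanSpace ℝ (Fin t),
      Measurable g ∧ (∀ u, ‖g u‖ ≤ C) ∧ f =ᵐ[volume] g := by
  have hmk : Measurable (hf.mk f) := hf.stronglyMeasurable_mk.measurable
  have hs : MeasurableSet {u | ‖hf.mk f u‖ ≤ C} := measurableSet_le hmk.norm measurable_const
  have hC0 : 0 ≤ C := (norm_nonneg _).trans (hC (fun _ => 0, fun _ => 0))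
  refine ⟨{u | ‖hf.mk f u‖ ≤ C}.indicator (hf.mk f), hmk.indicator hs, fun u => ?_, ?_⟩
  · by_cases hu : u ∈ {u | ‖hf.mk f u‖ ≤ C}
    · rw [Set.indicator_of_mem hu]
      exact hu
    · rw [Set.indicator_of_notMem hu]
      simpa using hC0
  · filter_upwards [hf.ae_eq_mk] with u hu
    have : u ∈ {u | ‖hf.mk f u‖ ≤ C} := by
      rw [Set.mem_ofPred_eq, ← hu]
      exact hC u
    rw [Set.indicator_of_mem this, hu]

lemma partialMean_ae_eq (h : f =ᵐ[volume] g) : partialMean f =ᵐ[volume] partialMean g := by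
  rw [Measure.volume_eq_prod] at h
  filter_upwards [Measure.ae_ae_of_ae_prod h] with q hq
  exact integral_congr_ae hq

lemma mixedCovariance_congr (h : f =ᵐ[volume] g) : mixedCovariance f = mixedCovariance g := by
  ext i j
  simp only [mixedCovariance, Matrix.of_apply]
  congr 1
  · refine integral_congr_ae ?_
    filter_upwards [h] with u hu
    rw [hu]
  · refine integral_congr_ae ?_
    filter_upwards [partialMean_ae_eq h] with q hq
    rw [hq]

/-- Each `(Q n, X n)` is uniform on the whole cube and each `Q n` on its factor, so a null set of
integrand values is almost surely never visited. -/
lemma centredMean_ae_eq (h : f =ᵐ[volume] g) {Q : ℕ → Ω → Fin d → I} {X : ℕ → Ω → Fin r → I}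
    (hQ : ∀ n, MeasurePreserving (Q n) P volume) (hX : ∀ n, MeasurePreserving (X n) P volume)
    (hQX : ∀ n, IndepFun (Q n) (X n) P) (N : ℕ) :
    ∀ᵐ ω ∂P, centredMean f (fun n => Q n ω) (fun n => X n ω) N =
      centredMean g (fun n => Q n ω) (fun n => X n ω) N := by
  have h1 : ∀ n, ∀ᵐ ω ∂P, f (Q n ω, X n ω) = g (Q n ω, X n ω) := fun n => by
    have hp : MeasurePreserving (fun ω => (Q n ω, X n ω)) P volume :=
      ⟨(hQ n).measurable.prodMk (hX n).measurable, by
        rw [(indepFun_iff_map_prod_eq_prod_map_map (hQ n).aemeasurable (hX n).aemeasurable).1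
          (hQX n), (hQ n).map_eq, (hX n).map_eq, Measure.volume_eq_prod]⟩
    exact hp.quasiMeasurePreserving.ae h
  have h2 : ∀ n, ∀ᵐ ω ∂P, partialMean f (Q n ω) = partialMean g (Q n ω) := fun n =>
    (hQ n).quasiMeasurePreserving.ae (partialMean_ae_eq h)
  filter_upwards [ae_all_iff.2 h1, ae_all_iff.2 h2] with ω hω hω'
  simp only [centredMean, hω, hω']

end Congr

end MixedRQMC

theorem theorem3 {Ω : Type*} [MeasurableSpace Ω] (P : Measure Ω) [IsProbabilityMeasure P]
    (d r t : ℕ)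
    -- a `(τ, d)`-sequence `a` in base `b`
    (b τ : ℕ) [NeZero b] (hb : 2 ≤ b)
    (a : ℕ → Fin d → ℝ) (ha : MixedRQMC.IsTDSequence b τ a)
    -- the random permutations that scramble it
    (π : Fin d → List (Fin b) → Ω → Equiv.Perm (Fin b)) (hπ : MixedRQMC.IsUniformScramble P π)
    -- the Monte Carlo part: i.i.d. uniform on `[0, 1]^r`, independent of the scrambling
    (X : ℕ → Ω → Fin r → unitInterval)
    (hX_meas : ∀ n, Measurable (X n)) (hX_law : ∀ n, P.map (X n) = volume)
    (hX_indep : iIndepFun X P)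
    (hπX : IndepFun (fun ω (i : Fin d × List (Fin b)) => π i.1 i.2 ω) (fun ω n => X n ω) P)
    -- the integrand: bounded and square integrable
    (f : (Fin d → unitInterval) × (Fin r → unitInterval) → EuclideanSpace ℝ (Fin t))
    (hf_bdd : ∃ C : ℝ, ∀ u, ‖f u‖ ≤ C) (hf_L2 : MemLp f 2 volume) :
    (MixedRQMC.mixedCovariance f).PosSemidef ∧
      TendstoInDistribution
        (fun (N : ℕ) (ω : Ω) => Real.sqrt N •
          MixedRQMC.centredMean f
            (fun n => MixedRQMC.scramblePoint (fun j l => π j l ω) (a n)) (fun n => X n ω) N)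
        atTop (id : EuclideanSpace ℝ (Fin t) → EuclideanSpace ℝ (Fin t)) (fun _ => P)
        (multivariateGaussian 0 (MixedRQMC.mixedCovariance f)) := by
  obtain ⟨C, hC⟩ := hf_bdd
  obtain ⟨g, hg, hgC, hfg⟩ :=
    MixedRQMC.exists_measurable_bounded_ae_eq hf_L2.aestronglyMeasurable hC
  have hindep := MixedRQMC.indepFun_scramblePoint (a := a) hπX
  rw [MixedRQMC.mixedCovariance_congr hfg]
  refine ⟨MixedRQMC.posSemidef_mixedCovariance hg hgC, ?_⟩
  refine (MixedRQMC.tendstoInDistribution_of_measurable hb ha hπ hX_meas hX_law hX_indep hπX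
    hg hgC).congr (fun N => ?_) .rfl
  filter_upwards [MixedRQMC.centredMean_ae_eq hfg
    (fun n => hπ.measurePreserving_scramblePoint hb (a n)) (fun n => ⟨hX_meas n, hX_law n⟩)
    (fun n => hindep.comp (measurable_pi_apply n) (measurable_pi_apply n)) N] with ω hω
  exact congrArg _ hω.symm
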